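/- Let $p$ be a prime, let $n\ge 0$ be an integer, and let $K=\{k_1,\dots,k_r\}$ (with $|K|=r\ge 1$) and $L=\{l_1,\dots,l_s\}$ (with $|L|=s\ge 0$) be disjoint subsets of $\{0,1,\dots,p-1\}$. Let $\mathcal A$ be a family of subsets of $[n]=\{1,\dots,n\}$ such that $|A| \bmod p\in K$ for every $A\in\mathcal A$ and $|A\cap B| \bmod p\in L$ for all distinct $A,B\in\mathcal A$. If $n\ge s+\max_{1\le i\le r}k_i$, then $$|\mathcal A|\le \binom{n-1}{s}+\binom{n-1}{s-1}+\cdots+\binom{n-1}{s-2r+1},$$ where $\binom{m}{j}=0$ for $j<0$ (and $\binom{-1}{0}=1$ in the degenerate case $n=0$). Moreover, if in addition $n\ge 2s-2$, then this bound is at least as strong as the Alon–Babai–Suzuki bound: $$\binom{n-1}{s}+\binom{n-1}{s-1}+\cdots+\binom{n-1}{s-2r+1}\le\binom{n}{s}+\binom{n}{s-1}+\cdots+\binom{n}{s-r+1},$$ and the inequality is strict if $r\ge 2$ and $s\ge 1$. -/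

import Mathlib

/-- The sum of binomial coefficients `C(m, t) + C(m, t - 1) + ⋯ + C(m, t - l + 1)` with `l` terms,
where `C(m, j) = 0` for negative `j`: the lower end `t + 1 - l` is a truncated subtraction,
so the sum stops at `C(m, 0)` when `l > t + 1`. -/
def chooseSum (m t l : ℕ) : ℕ := ∑ j ∈ Finset.Icc (t + 1 - l) t, m.choose j

/-! Fix a point `e`, put `U = [n] \ {e}`, `s = |L|`, `r = |K|`, and use multilinear polynomials over
`ZMod p` in the variables of `U`. Each `A` gives `g A X = ∏ l ∈ L, (|(A \ e) ∩ X| + [e ∈ A] - l)`,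
of degree at most `s`. The polynomial `f X = ∏ k ∈ K, (|X| - k)(|X| + 1 - k)` has degree at most
`2r` and vanishes at every `A \ e`. If the `g A` and the `f * x_I` with `|I| ≤ s - 2r` are linearly
independent, counting dimensions in degree at most `s` leaves exactly the `2r` top binomials for the
family (`card_add_sum_choose_le`). Evaluating a relation at the sets `B \ e` removes the `g A`. What
remains is a polynomial of degree at most `s - 2r` vanishing at every `X ⊆ U` with `|X|` outside `K
∪ (K - 1)` mod `p`. It is zero by `sum_powerset_eq_zero_of_vanishing`, whose supply of sizes is
`exists_injOn_sizes`; there the bound on `n` enters. The comparison of bounds is Pascal's rule plus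
monotonicity of binomials. -/

/-! ### Multilinear polynomials vanishing on subsets of prescribed sizes -/

open Finset in
theorem eq_zero_of_sum_powerset_eq_zero {α F : Type*} [DecidableEq α] [AddCommGroup F]
    {U : Finset α} {c : Finset α → F} (h : ∀ X ⊆ U, ∑ I ∈ X.powerset, c I = 0) :
    ∀ X ⊆ U, c X = 0 := by
  intro X
  induction X using Finset.strongInduction with
  | H X ih =>
    intro hX
    have h1 := h X hX
    rw [← Finset.add_sum_erase _ _ (Finset.mem_powerset_self X), Finset.sum_eq_zero, add_zero] at h1
    · exact h1
    · intro I hI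
      rw [Finset.mem_erase, Finset.mem_powerset] at hI
      exact ih I (Finset.ssubset_iff_subset_ne.2 ⟨hI.2, hI.1⟩) (hI.2.trans hX)

-- Swapping elements of `I \ J` one at a time for elements of `J \ I` leads from `I` to `J`.
open Finset in
theorem eq_of_card_eq_of_exchange {α F : Type*} [DecidableEq α] {U : Finset α} {c : Finset α → F}
    (h : ∀ a ∈ U, ∀ b ∈ U, a ≠ b → ∀ X ⊆ (U.erase a).erase b, c (insert a X) = c (insert b X)) :
    ∀ I ⊆ U, ∀ J ⊆ U, #I = #J → c I = c J := by
  intro I hI J hJ hIJ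
  induction hm : #(I \ J) generalizing I with
  | zero =>
    rw [Finset.card_eq_zero, Finset.sdiff_eq_empty_iff_subset] at hm
    rw [Finset.eq_of_subset_of_card_le hm hIJ.ge]
  | succ m ih =>
    have hm' : #(J \ I) = m + 1 := by
      rw [← hm]; exact (Finset.card_sdiff_comm hIJ).symm
    obtain ⟨a, ha⟩ : (I \ J).Nonempty := by rw [← Finset.card_pos]; omega
    obtain ⟨b, hb⟩ : (J \ I).Nonempty := by rw [← Finset.card_pos]; omega
    rw [Finset.mem_sdiff] at ha hb
    have hab : a ≠ b := by rintro rfl; exact ha.2 hb.1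
    have hbI : b ∉ I.erase a := fun h => hb.2 (Finset.mem_of_mem_erase h)
    have hs := h a (hI ha.1) b (hJ hb.1) hab (I.erase a) (by
      intro x hx
      have hx' := Finset.mem_of_mem_erase hx
      refine Finset.mem_erase.2 ⟨?_, Finset.mem_erase.2 ⟨Finset.ne_of_mem_erase hx, hI hx'⟩⟩
      rintro rfl; exact hb.2 hx')
    rw [Finset.insert_erase ha.1] at hs
    rw [hs]
    apply ih
    · intro x hx
      rcases Finset.mem_insert.1 hx with rfl | hx
      · exact hJ hb.1
      · exact hI (Finset.mem_of_mem_erase hx)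
    · rw [Finset.card_insert_of_notMem hbI, Finset.card_erase_add_one ha.1, hIJ]
    · rw [Finset.insert_sdiff_of_mem _ hb.1, Finset.erase_sdiff_comm,
        Finset.card_erase_of_mem (Finset.mem_sdiff.2 ha), hm]
      rfl

-- For `j ≤ m < p` the factorial `j!` is invertible, so the sum is a polynomial in `t` of degree at
-- most `m`, with more than `m` roots.
open Finset Polynomial in
theorem sum_choose_mul_eq_zero {p : ℕ} [Fact p.Prime] (γ : ℕ → ZMod p) {m : ℕ} (hm : m < p)
    (T : Finset ℕ) (hinj : Set.InjOn (fun t : ℕ => (t : ZMod p)) T) (hT : m < #T)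
    (h : ∀ t ∈ T, ∑ j ∈ range (m + 1), (t.choose j : ZMod p) * γ j = 0) (t : ℕ) :
    ∑ j ∈ range (m + 1), (t.choose j : ZMod p) * γ j = 0 := by
  set Q : (ZMod p)[X] :=
    ∑ j ∈ range (m + 1), C (γ j / (j.factorial : ZMod p)) * descPochhammer (ZMod p) j with hQ
  have hev : ∀ t : ℕ, Q.eval (t : ZMod p) = ∑ j ∈ range (m + 1), (t.choose j : ZMod p) * γ j := by
    intro t
    rw [hQ, eval_finsetSum]
    refine Finset.sum_congr rfl fun j hj => ?_
    have hj' : (j.factorial : ZMod p) ≠ 0 := by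
      rw [Ne, ZMod.natCast_eq_zero_iff, (Fact.out : p.Prime).dvd_factorial]
      have := Finset.mem_range.1 hj
      omega
    rw [eval_mul, eval_C, descPochhammer_eval_eq_descFactorial,
      Nat.descFactorial_eq_factorial_mul_choose, Nat.cast_mul]
    field_simp
  have hdeg : Q.natDegree ≤ m := by
    refine natDegree_sum_le_of_forall_le _ _ fun j hj => ?_
    refine (natDegree_C_mul_le _ _).trans ?_
    rw [descPochhammer_natDegree]
    have := Finset.mem_range.1 hj
    omega
  have h0 : Q = 0 := by
    refine eq_zero_of_natDegree_lt_card_of_eval_eq_zero' Q (T.image fun t : ℕ => (t : ZMod p)) ?_ ?_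
    · intro x hx
      obtain ⟨t, ht, rfl⟩ := Finset.mem_image.1 hx
      rw [hev, h t ht]
    · rw [Finset.card_image_of_injOn hinj]; omega
  rw [← hev, h0, eval_zero]

open Finset in
theorem sum_powerset_eq_zero_of_symmetric {α : Type*} [DecidableEq α] {p : ℕ} [Fact p.Prime]
    {U : Finset α} {c : Finset α → ZMod p} {d : ℕ} (hd : d < p) (hc : ∀ I, d < #I → c I = 0)
    (hsymm : ∀ I ⊆ U, ∀ J ⊆ U, #I = #J → c I = c J) (T : Finset ℕ) (hTU : ∀ t ∈ T, t ≤ #U)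
    (hinj : Set.InjOn (fun t : ℕ => (t : ZMod p)) T) (hT : min d #U < #T)
    (h : ∀ X ⊆ U, #X ∈ T → ∑ I ∈ X.powerset, c I = 0) :
    ∀ X ⊆ U, ∑ I ∈ X.powerset, c I = 0 := by
  have hex : ∀ j, ∃ g : ZMod p, ∀ I ⊆ U, #I = j → c I = g := by
    intro j
    by_cases hj : ∃ I ⊆ U, #I = j
    · obtain ⟨I, hI, hIj⟩ := hj
      exact ⟨c I, fun J hJ hJj => hsymm J hJ I hI (hJj.trans hIj.symm)⟩
    · exact ⟨0, fun I hI hIj => (hj ⟨I, hI, hIj⟩).elim⟩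
  choose γ hγ using hex
  have hsum : ∀ X ⊆ U, ∑ I ∈ X.powerset, c I =
      ∑ j ∈ range (min d #U + 1), ((#X).choose j : ZMod p) * γ j := by
    intro X hX
    have hXU := Finset.card_le_card hX
    have h1 : ∑ I ∈ X.powerset, c I = ∑ I ∈ X.powerset, γ #I :=
      Finset.sum_congr rfl fun I hI => hγ _ I ((Finset.mem_powerset.1 hI).trans hX) rfl
    rw [h1, Finset.sum_powerset_apply_card γ]
    simp only [nsmul_eq_mul]
    have h2 : ∀ j, j ≤ #U → d < j → γ j = 0 := by
      intro j hj hdj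
      obtain ⟨I, hI, hIj⟩ := Finset.exists_subset_card_eq hj
      rw [← hγ j I hI hIj, hc I (by omega)]
    rw [Finset.sum_subset (s₂ := range (#U + 1)) (Finset.range_mono (by omega)),
      Finset.sum_subset (s₁ := range (min d #U + 1)) (s₂ := range (#U + 1))
        (Finset.range_mono (by omega))]
    · intro j hj hj'
      simp only [Finset.mem_range] at hj hj'
      rw [h2 j (by omega) (by omega), mul_zero]
    · intro j hj hj'
      rw [Nat.choose_eq_zero_of_lt, Nat.cast_zero, zero_mul]
      simp at hj'; omega
  intro X hX
  rw [hsum X hX]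
  refine sum_choose_mul_eq_zero γ (by omega) T hinj hT (fun t ht => ?_) _
  obtain ⟨Y, hY, rfl⟩ := Finset.exists_subset_card_eq (hTU t ht)
  rw [← hsum Y hY, h Y hY ht]

open Finset in
theorem sum_powerset_insert_sub {α F : Type*} [DecidableEq α] [AddCommGroup F] (c : Finset α → F)
    {a b : α} {X : Finset α} (ha : a ∉ X) (hb : b ∉ X) :
    ∑ I ∈ X.powerset, (c (insert a I) - c (insert b I)) =
      ∑ I ∈ (insert a X).powerset, c I - ∑ I ∈ (insert b X).powerset, c I := by
  rw [Finset.sum_powerset_insert ha, Finset.sum_powerset_insert hb, Finset.sum_sub_distrib]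
  abel

open Finset in
/-- A multilinear polynomial of degree at most `d < p` over `ZMod p` that vanishes on all subsets
of `U` with size outside `S` is zero, if for each `j` enough residues of sizes in `[j, |U| - j]`
avoid `S`. -/
theorem sum_powerset_eq_zero_of_vanishing {α : Type*} [DecidableEq α] {p : ℕ} [Fact p.Prime]
    (d : ℕ) (hd : d < p) (U : Finset α) (c : Finset α → ZMod p) (hc : ∀ I, d < #I → c I = 0)
    (S : ℕ → Prop)
    (hT : ∀ j ≤ d, 2 * j ≤ #U → ∃ T : Finset ℕ, (∀ t ∈ T, t ≤ #U - 2 * j ∧ ¬ S (t + j)) ∧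
      Set.InjOn (fun t : ℕ => (t : ZMod p)) T ∧ min (d - j) (#U - 2 * j) < #T)
    (h : ∀ X ⊆ U, ¬ S #X → ∑ I ∈ X.powerset, c I = 0) :
    ∀ X ⊆ U, ∑ I ∈ X.powerset, c I = 0 := by
  induction d generalizing U c S with
  | zero =>
    obtain ⟨T, hT1, hT2, hT3⟩ := hT 0 le_rfl (by omega)
    refine sum_powerset_eq_zero_of_symmetric hd hc ?_ T (fun t ht => (hT1 t ht).1) hT2 hT3
      (fun X hX hXT => h X hX (hT1 _ hXT).2)
    refine eq_of_card_eq_of_exchange fun a _ b _ _ X _ => ?_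
    rw [hc _ (Finset.card_pos.2 (Finset.insert_nonempty _ _)),
      hc _ (Finset.card_pos.2 (Finset.insert_nonempty _ _))]
  | succ d ih =>
    obtain ⟨T, hT1, hT2, hT3⟩ := hT 0 (Nat.zero_le _) (by omega)
    refine sum_powerset_eq_zero_of_symmetric hd hc ?_ T (fun t ht => (hT1 t ht).1) hT2
      (by simpa using hT3)
      (fun X hX hXT => h X hX (hT1 _ hXT).2)
    -- The difference of the coefficients at `insert a I` and `insert b I` defines a polynomial of
    -- lower degree on `U` minus two points, with sizes shifted by one; by induction it vanishes.
    refine eq_of_card_eq_of_exchange fun a ha b hb hab => ?_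
    set V := (U.erase a).erase b with hV
    have hbU : b ∈ U.erase a := Finset.mem_erase.2 ⟨hab.symm, hb⟩
    have hcardV : #V + 2 = #U := by
      have h1 := Finset.card_erase_add_one hbU
      have h2 := Finset.card_erase_add_one ha
      rw [← h2, ← h1]
    have haV : a ∉ V := by simp [hV]
    have hbV : b ∉ V := by simp [hV]
    have hVU : V ⊆ U := (Finset.erase_subset _ _).trans (Finset.erase_subset _ _)
    -- The value 0 on sets meeting `{a, b}` keeps the degree bound true for all `I`, since inserting
    -- a present element would not raise the size.
    set c' : Finset α → ZMod p :=
      fun I => if a ∈ I ∨ b ∈ I then 0 else c (insert a I) - c (insert b I) with hc'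
    have hc'V : ∀ I ⊆ V, c' I = c (insert a I) - c (insert b I) := fun I hI =>
      if_neg (not_or.2 ⟨fun h => haV (hI h), fun h => hbV (hI h)⟩)
    have hsum : ∀ X ⊆ V, ∑ I ∈ X.powerset, c' I = 0 := by
      refine ih (by omega) V c' ?_ (fun t => S (t + 1)) ?_ ?_
      · intro I hI
        by_cases hab' : a ∈ I ∨ b ∈ I
        · exact if_pos hab'
        · rw [hc']
          simp only [if_neg hab']
          rw [not_or] at hab'
          rw [hc, hc, sub_zero]
          · rw [Finset.card_insert_of_notMem hab'.2]; omega
          · rw [Finset.card_insert_of_notMem hab'.1]; omega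
      · intro j hj hjV
        obtain ⟨T, h1, h2, h3⟩ := hT (j + 1) (by omega) (by omega)
        refine ⟨T, fun t ht => ⟨?_, (h1 t ht).2⟩, h2, ?_⟩
        · have := (h1 t ht).1; omega
        · omega
      · intro X hX hXS
        have ha' : a ∉ X := fun h => haV (hX h)
        have hb' : b ∉ X := fun h => hbV (hX h)
        rw [Finset.sum_congr rfl fun I hI => hc'V I ((Finset.mem_powerset.1 hI).trans hX),
          sum_powerset_insert_sub c ha' hb', h, h, sub_zero]
        · exact Finset.insert_subset hb (hX.trans hVU)
        · rwa [Finset.card_insert_of_notMem hb']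
        · exact Finset.insert_subset ha (hX.trans hVU)
        · rwa [Finset.card_insert_of_notMem ha']
    intro X hX
    have := eq_zero_of_sum_powerset_eq_zero hsum X hX
    rw [hc'V X hX, sub_eq_zero] at this
    exact this

/-! ### The space of multilinear polynomials of bounded degree -/

/-- The multilinear monomial with variable set `I`, as a function on finite sets. -/
def setMonomial (F : Type*) [Field F] {α : Type*} [DecidableEq α] (I : Finset α) :
    Finset α → F := fun X => if I ⊆ X then 1 else 0

open Finset in
/-- The subsets of `U` with at most `d` elements. -/
def smallSubsets {α : Type*} (U : Finset α) (d : ℕ) : Finset (Finset α) :=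
  {I ∈ U.powerset | #I ≤ d}

/-- The functions given by multilinear polynomials of degree at most `d` in variables from `U`. -/
def multilinearSpan (F : Type*) [Field F] {α : Type*} [DecidableEq α] (U : Finset α) (d : ℕ) :
    Submodule F (Finset α → F) :=
  Submodule.span F (setMonomial F '' (smallSubsets U d : Set (Finset α)))

section

open Finset

theorem mem_smallSubsets {α : Type*} {U : Finset α} {d : ℕ} {I : Finset α} : I ∈ smallSubsets U d ↔ I ⊆ U ∧ #I ≤ d := by
  simp [smallSubsets]

theorem card_smallSubsets {α : Type*} (U : Finset α) (d : ℕ) :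
    #(smallSubsets U d) = ∑ j ∈ range (d + 1), (#U).choose j := by
  rw [smallSubsets, Finset.card_filter,
    Finset.sum_powerset_apply_card (fun m => if m ≤ d then 1 else 0)]
  simp only [smul_eq_mul, mul_ite, mul_one, mul_zero]
  rw [← Finset.sum_filter]
  refine Finset.sum_subset ?_ fun j hj hj' => ?_
  · intro j; simp
  · simp at hj hj'
    exact Nat.choose_eq_zero_of_lt (by omega)

variable {F : Type*} [Field F] {α : Type*} [DecidableEq α] {U : Finset α} {d : ℕ}

theorem setMonomial_mem_multilinearSpan {I : Finset α} (hI : I ⊆ U) (hId : #I ≤ d) :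
    setMonomial F I ∈ multilinearSpan F U d :=
  Submodule.subset_span ⟨I, mem_smallSubsets.2 ⟨hI, hId⟩, rfl⟩

theorem multilinearSpan_induction {V : Submodule F (Finset α → F)}
    (T : (Finset α → F) →ₗ[F] (Finset α → F))
    (h : ∀ I ⊆ U, #I ≤ d → T (setMonomial F I) ∈ V) {φ : Finset α → F}
    (hφ : φ ∈ multilinearSpan F U d) : T φ ∈ V := by
  have : multilinearSpan F U d ≤ V.comap T := by
    refine Submodule.span_le.2 ?_
    rintro _ ⟨I, hI, rfl⟩
    rw [Finset.mem_coe, mem_smallSubsets] at hI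
    exact h I hI.1 hI.2
  exact this hφ

theorem mul_mem_multilinearSpan {A : Finset α} (hA : A ⊆ U) (r : F) {φ : Finset α → F}
    (hφ : φ ∈ multilinearSpan F U d) :
    (fun X => ((#(A ∩ X) : F) + r) * φ X) ∈ multilinearSpan F U (d + 1) := by
  refine multilinearSpan_induction (LinearMap.mulLeft F fun X => (#(A ∩ X) : F) + r)
    (fun I hI hId => ?_) hφ
  -- On 0-1 points `x_a * x_I = x_(I ∪ {a})`, so the product stays multilinear.
  have : LinearMap.mulLeft F (fun X => (#(A ∩ X) : F) + r) (setMonomial F I) =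
      ∑ a ∈ A, setMonomial F (insert a I) + r • setMonomial F I := by
    funext X
    simp only [LinearMap.mulLeft_apply, Pi.mul_apply, Pi.add_apply, Pi.smul_apply, smul_eq_mul,
      Finset.sum_apply, setMonomial, Finset.insert_subset_iff]
    by_cases hIX : I ⊆ X
    · simp [hIX]
    · simp [hIX]
  rw [this]
  refine Submodule.add_mem _ (Submodule.sum_mem _ fun a ha => ?_) (Submodule.smul_mem _ _ ?_)
  · exact setMonomial_mem_multilinearSpan (Finset.insert_subset (hA ha) hI)
      ((Finset.card_insert_le _ _).trans (by omega))
  · exact setMonomial_mem_multilinearSpan hI (by omega)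

theorem prod_mul_mem_multilinearSpan {ι : Type*} [DecidableEq ι] {A : Finset α} (hA : A ⊆ U)
    (s : Finset ι) (r : ι → F) {φ : Finset α → F} (hφ : φ ∈ multilinearSpan F U d) :
    (fun X => (∏ i ∈ s, ((#(A ∩ X) : F) + r i)) * φ X) ∈ multilinearSpan F U (d + #s) := by
  induction s using Finset.induction_on with
  | empty => simpa using hφ
  | insert i s hi ih =>
    rw [Finset.card_insert_of_notMem hi, ← add_assoc]
    have := mul_mem_multilinearSpan hA (r i) ih
    simpa only [Finset.prod_insert hi, mul_assoc] using this

theorem card_le_card_smallSubsets {ι : Type*} [Fintype ι] {v : ι → Finset α → F}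
    (hv : LinearIndependent F v) (h : ∀ i, v i ∈ multilinearSpan F U d) :
    Fintype.card ι ≤ #(smallSubsets U d) := by
  classical
  have := linearIndependent_le_span_aux' v hv
    (((smallSubsets U d).image (setMonomial F) : Finset (Finset α → F)) : Set (Finset α → F))
    (by rintro _ ⟨i, rfl⟩; rw [Finset.coe_image]; exact h i)
  refine this.trans (le_trans (le_of_eq ?_) (Finset.card_image_le (f := setMonomial F)))
  simp

end

/-! ### Sums of binomial coefficients -/

open Finset in
theorem chooseSum_eq_sum_range (m t l : ℕ) :
    chooseSum m t l = ∑ i ∈ range l, if i ≤ t then m.choose (t - i) else 0 := by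
  rw [chooseSum, ← Finset.sum_filter]
  refine Finset.sum_nbij' (fun j => t - j) (fun i => t - i) ?_ ?_ ?_ ?_ ?_
  · intro j hj; simp at hj ⊢; omega
  · intro j hj; simp at hj ⊢; omega
  · intro j hj; simp at hj ⊢; omega
  · intro j hj; simp at hj ⊢; omega
  · intro j hj
    simp at hj
    congr 1; omega

open Finset in
theorem chooseSum_add_sum_range_le (m s l : ℕ) :
    chooseSum m s l + (if l ≤ s then ∑ j ∈ range (s - l + 1), m.choose j else 0) =
      ∑ j ∈ range (s + 1), m.choose j := by
  rw [chooseSum]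
  split_ifs with h
  · have : Finset.Icc (s + 1 - l) s = Finset.Ico (s - l + 1) (s + 1) := by
      ext; simp; omega
    rw [this, add_comm, Finset.sum_range_add_sum_Ico _ (by omega)]
  · rw [add_zero, Nat.sub_eq_zero_of_le (by omega)]
    refine Finset.sum_congr ?_ fun _ _ => rfl
    ext; simp

theorem choose_le_choose_succ {m j : ℕ} (h : 2 * j + 1 ≤ m) : m.choose j ≤ m.choose (j + 1) := by
  have h1 := Nat.choose_succ_right_eq m j
  have h2 : j + 1 ≤ m - j := by omega
  have h3 : m.choose j * (j + 1) ≤ m.choose (j + 1) * (j + 1) := by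
    rw [h1]; exact Nat.mul_le_mul_left _ h2
  exact Nat.le_of_mul_le_mul_right h3 (Nat.succ_pos j)

theorem choose_lt_choose_succ {m j : ℕ} (h : 2 * j + 2 ≤ m) : m.choose j < m.choose (j + 1) := by
  have h1 := Nat.choose_succ_right_eq m j
  have h2 : j + 1 < m - j := by omega
  have h3 : m.choose j * (j + 1) < m.choose (j + 1) * (j + 1) := by
    rw [h1]; exact Nat.mul_lt_mul_of_pos_left h2 (Nat.choose_pos (by omega))
  exact Nat.lt_of_mul_lt_mul_right h3

open Finset in
theorem chooseSum_two_mul_le {N s r : ℕ} (hs : 2 * s ≤ N + 3) :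
    chooseSum N s (2 * r) ≤ chooseSum (N + 1) s r ∧
      (2 ≤ r → 1 ≤ s → chooseSum N s (2 * r) < chooseSum (N + 1) s r) := by
  set a : ℕ → ℕ := fun i => if i ≤ s then N.choose (s - i) else 0 with ha
  have hstep : ∀ i, 1 ≤ i → a (i + 1) ≤ a i := by
    intro i hi
    by_cases h : i + 1 ≤ s
    · simp only [ha, if_pos h, if_pos (show i ≤ s by omega)]
      rw [show s - i = s - (i + 1) + 1 by omega]
      exact choose_le_choose_succ (by omega)
    · simp only [ha, if_neg h, Nat.zero_le]
  have hanti : ∀ i, 1 ≤ i → ∀ k, a (i + k) ≤ a i := by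
    intro i hi k
    induction k with
    | zero => exact le_rfl
    | succ k ih => exact (hstep (i + k) (by omega)).trans ih
  have hL : chooseSum N s (2 * r) = ∑ i ∈ range r, a i + ∑ i ∈ range r, a (r + i) := by
    rw [chooseSum_eq_sum_range, two_mul, Finset.sum_range_add]
  -- Pascal's rule; it remains to compare `a (r + i)` with `a (i + 1)`, and `a` decreases from index
  -- 1 on.
  have hR : chooseSum (N + 1) s r = ∑ i ∈ range r, a i + ∑ i ∈ range r, a (i + 1) := by
    rw [chooseSum_eq_sum_range, ← Finset.sum_add_distrib]
    refine Finset.sum_congr rfl fun i _ => ?_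
    by_cases h : i + 1 ≤ s
    · simp only [ha, if_pos h, if_pos (show i ≤ s by omega)]
      rw [show s - i = s - (i + 1) + 1 by omega, Nat.choose_succ_succ, add_comm]
    · by_cases h' : i ≤ s
      · simp [ha, h', h, show s - i = 0 by omega]
      · simp [ha, h', h]
  have hle : ∀ i ∈ range r, a (r + i) ≤ a (i + 1) := by
    intro i hi
    have := Finset.mem_range.1 hi
    rw [show r + i = i + 1 + (r - 1) by omega]
    exact hanti _ (by omega) _
  rw [hL, hR]
  refine ⟨Nat.add_le_add_left (Finset.sum_le_sum hle) _, fun hr hs1 => Nat.add_lt_add_left ?_ _⟩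
  refine Finset.sum_lt_sum hle ?_
  -- Index 0 can give equality when `s ≥ 2` (`a 1 = a 2` if `N = 2s - 3`), so index 1 is used there;
  -- for `s = 1` index 1 gives `0 = 0`.
  rcases Nat.lt_or_ge s 2 with h2 | h2
  · refine ⟨0, Finset.mem_range.2 (by omega), ?_⟩
    simp [ha, show s = 1 by omega, show ¬ r ≤ 1 by omega]
  · refine ⟨1, Finset.mem_range.2 (by omega), ?_⟩
    have h3 : a (r + 1) ≤ a 3 := by
      rw [show r + 1 = 3 + (r - 2) by omega]
      exact hanti _ (by omega) _
    refine h3.trans_lt ?_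
    by_cases h : 3 ≤ s
    · simp only [ha, if_pos h, if_pos h2, Nat.reduceAdd]
      rw [show s - 2 = s - 3 + 1 by omega]
      exact choose_lt_choose_succ (by omega)
    · simp [ha, show s = 2 by omega]

/-! ### Counting the sizes that avoid `K` and `K - 1` -/

open Finset in
theorem exists_injOn_sizes {p N s r M : ℕ} [Fact p.Prime] {K : Finset ℕ} (hr : #K = r)
    (hr0 : 1 ≤ r) (hKp : ∀ k ∈ K, k < p) (hKM : ∀ k ∈ K, k ≤ M) (hsp : s + r ≤ p)
    (hN : s + M ≤ N + 1) (hrs : 2 * r ≤ s) {j : ℕ} (hj : j ≤ s - 2 * r) (hjN : 2 * j ≤ N) :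
    ∃ T : Finset ℕ, (∀ t ∈ T, t ≤ N - 2 * j ∧
        ¬ ∃ k ∈ K, ((t + j : ℕ) : ZMod p) = k ∨ ((t + j : ℕ) : ZMod p) + 1 = k) ∧
      Set.InjOn (fun t : ℕ => (t : ZMod p)) T ∧ min (s - 2 * r - j) (N - 2 * j) < #T := by
  classical
  set S : ℕ → Prop :=
    fun t => ∃ k ∈ K, ((t + j : ℕ) : ZMod p) = k ∨ ((t + j : ℕ) : ZMod p) + 1 = k with hS
  set R := range (min p (N - 2 * j + 1)) with hR
  have hinj : Set.InjOn (fun t : ℕ => (t : ZMod p)) R := by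
    intro x hx y hy hxy
    simp only [hR, Finset.coe_range, Set.mem_Iio] at hx hy
    have := (ZMod.natCast_eq_natCast_iff' x y p).1 hxy
    rwa [Nat.mod_eq_of_lt (by omega), Nat.mod_eq_of_lt (by omega)] at this
  have hbad : #{t ∈ R | S t} ≤ 2 * r := by
    have h1 : #{t ∈ R | S t} ≤ #(K.image (fun k : ℕ => (k : ZMod p) - j) ∪
        K.image (fun k : ℕ => (k : ZMod p) - 1 - j)) := by
      refine Finset.card_le_card_of_injOn (fun t : ℕ => (t : ZMod p)) ?_
        (hinj.mono (Finset.coe_subset.2 (Finset.filter_subset _ _)))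
      intro t ht
      obtain ⟨k, hk, h | h⟩ := (Finset.mem_filter.1 ht).2
      · refine Finset.mem_union_left _ (Finset.mem_image.2 ⟨k, hk, ?_⟩)
        rw [← h]; push_cast; ring
      · refine Finset.mem_union_right _ (Finset.mem_image.2 ⟨k, hk, ?_⟩)
        rw [← h]; push_cast; ring
    have h2 := (Finset.card_union_le (K.image (fun k : ℕ => (k : ZMod p) - j))
      (K.image (fun k : ℕ => (k : ZMod p) - 1 - j)))
    have h3 := Finset.card_image_le (s := K) (f := fun k : ℕ => (k : ZMod p) - j)
    have h4 := Finset.card_image_le (s := K) (f := fun k : ℕ => (k : ZMod p) - 1 - j)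
    omega
  have hcard : #{t ∈ R | S t} + #{t ∈ R | ¬ S t} = min p (N - 2 * j + 1) := by
    rw [Finset.card_filter_add_card_filter_not, hR, Finset.card_range]
  refine ⟨{t ∈ R | ¬ S t}, fun t ht => ?_, hinj.mono (Finset.coe_subset.2
    (Finset.filter_subset _ _)), ?_⟩
  · rw [Finset.mem_filter, hR, Finset.mem_range] at ht
    exact ⟨by omega, ht.2⟩
  -- In these two cases discarding `2r` bad sizes leaves enough. Otherwise `M ≤ j`, so the only
  -- possible bad size is `t = 0`, with `k = M = j`.
  · by_cases h : p ≤ N - 2 * j + 1 ∨ j + s ≤ N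
    · omega
    · have hsmall : ∀ t ∈ ({t ∈ R | S t} : Finset ℕ), t = 0 ∧ j ≤ M := by
        intro t ht
        rw [Finset.mem_filter, hR, Finset.mem_range] at ht
        obtain ⟨ht, k, hk, h' | h'⟩ := ht
        · have h2 := (ZMod.natCast_eq_natCast_iff' _ _ p).1 h'
          rw [Nat.mod_eq_of_lt (by omega), Nat.mod_eq_of_lt (hKp k hk)] at h2
          have := hKM k hk
          omega
        · have h2 := (ZMod.natCast_eq_natCast_iff' (t + j + 1) k p).1 (by exact_mod_cast h')
          rw [Nat.mod_eq_of_lt (by omega), Nat.mod_eq_of_lt (hKp k hk)] at h2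
          have := hKM k hk
          omega
      have h1 : #{t ∈ R | S t} ≤ 1 := Finset.card_le_one.2 fun a ha b hb => by
        rw [(hsmall a ha).1, (hsmall b hb).1]
      rcases Finset.eq_empty_or_nonempty ({t ∈ R | S t} : Finset ℕ) with h0 | ⟨t, ht⟩
      · rw [h0, Finset.card_empty] at hcard
        omega
      · have := (hsmall t ht).2
        omega

/-! ### Linear independence and the bound -/

open Finset in
theorem card_add_sum_choose_le {p n : ℕ} [Fact p.Prime] {K L : Finset ℕ}
    (hLp : ∀ l ∈ L, l < p) (hKL : Disjoint K L) (𝒜 : Finset (Finset (Fin n)))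
    (hcard : ∀ A ∈ 𝒜, #A % p ∈ K)
    (hinter : ∀ A ∈ 𝒜, ∀ B ∈ 𝒜, A ≠ B → #(A ∩ B) % p ∈ L) (e : Fin n)
    (D : Finset (Finset (Fin n))) (hD : D ⊆ smallSubsets (univ.erase e) (#L - 2 * #K))
    (hDL : D.Nonempty → 2 * #K ≤ #L)
    (hvanish : ∀ c : Finset (Fin n) → ZMod p, (∀ I ∉ D, c I = 0) →
      (∀ X ⊆ univ.erase e, (¬ ∃ k ∈ K, (#X : ZMod p) = k ∨ (#X : ZMod p) + 1 = k) →
        ∑ I ∈ X.powerset, c I = 0) → ∀ X ⊆ univ.erase e, ∑ I ∈ X.powerset, c I = 0) :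
    #𝒜 + #D ≤ ∑ j ∈ range (#L + 1), (n - 1).choose j := by
  set U : Finset (Fin n) := univ.erase e with hU
  have hUcard : #U = n - 1 := by
    rw [hU, Finset.card_erase_of_mem (Finset.mem_univ e), Finset.card_univ, Fintype.card_fin]
  set g : Finset (Fin n) → Finset (Fin n) → ZMod p := fun A X =>
    ∏ l ∈ L, ((#(A.erase e ∩ X) : ZMod p) + ((if e ∈ A then 1 else 0) - (l : ZMod p))) with hg
  set f : Finset (Fin n) → ZMod p := fun X =>
    (∏ k ∈ K, ((#(U ∩ X) : ZMod p) + -(k : ZMod p))) *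
      ∏ k ∈ K, ((#(U ∩ X) : ZMod p) + (1 - (k : ZMod p))) with hf
  have heU : ∀ A : Finset (Fin n), A.erase e ⊆ U := fun A =>
    Finset.erase_subset_erase _ (Finset.subset_univ A)
  have hcasteq : ∀ a l : ℕ, l < p → (a : ZMod p) = l → a % p = l := by
    intro a l hl h
    rw [ZMod.natCast_eq_natCast_iff'] at h
    rw [h, Nat.mod_eq_of_lt hl]
  have hmod : ∀ a : ℕ, ((a % p : ℕ) : ZMod p) = a := fun a => ZMod.natCast_mod a p
  have hg0 : ∀ A ∈ 𝒜, ∀ B ∈ 𝒜, A ≠ B → (e ∈ B ∨ e ∉ A) → g A (B.erase e) = 0 := by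
    intro A hA B hB hAB he
    refine Finset.prod_eq_zero (hinter A hA B hB hAB) ?_
    have hAB' : A.erase e ∩ B.erase e = (A ∩ B).erase e := by
      ext x; simp only [Finset.mem_inter, Finset.mem_erase]; tauto
    rw [hmod, hAB']
    by_cases heA : e ∈ A
    · have heAB : e ∈ A ∩ B := Finset.mem_inter.2 ⟨heA, he.resolve_right (not_not.2 heA)⟩
      rw [if_pos heA, ← Finset.card_erase_add_one heAB]
      push_cast; ring
    · have heAB : e ∉ A ∩ B := fun h => heA (Finset.mem_inter.1 h).1
      rw [if_neg heA, Finset.erase_eq_of_notMem heAB]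
      ring
  have hg1 : ∀ A ∈ 𝒜, g A (A.erase e) ≠ 0 := by
    intro A hA
    refine Finset.prod_ne_zero_iff.2 fun l hl h => ?_
    refine Finset.disjoint_left.1 hKL (hcard A hA) ?_
    rw [hcasteq #A l (hLp l hl)]
    · exact hl
    · rw [Finset.inter_self] at h
      by_cases heA : e ∈ A
      · rw [if_pos heA] at h
        rw [← Finset.card_erase_add_one heA]
        push_cast
        linear_combination h
      · rw [if_neg heA, Finset.erase_eq_of_notMem heA] at h
        linear_combination h
  have hfeval : ∀ X ⊆ U, f X = (∏ k ∈ K, ((#X : ZMod p) + -(k : ZMod p))) *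
      ∏ k ∈ K, ((#X : ZMod p) + (1 - (k : ZMod p))) := by
    intro X hX
    simp only [hf, Finset.inter_eq_right.2 hX]
  have hf0 : ∀ A ∈ 𝒜, f (A.erase e) = 0 := by
    intro A hA
    rw [hfeval _ (heU A)]
    by_cases heA : e ∈ A
    · rw [Finset.prod_eq_zero (s := K) (f := fun k : ℕ =>
        ((#(A.erase e) : ZMod p) + (1 - (k : ZMod p)))) (hcard A hA), mul_zero]
      rw [hmod, ← Finset.card_erase_add_one heA]
      push_cast; ring
    · rw [Finset.prod_eq_zero (s := K) (f := fun k : ℕ =>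
        ((#(A.erase e) : ZMod p) + -(k : ZMod p))) (hcard A hA), zero_mul]
      rw [hmod, Finset.erase_eq_of_notMem heA]
      ring
  have hf1 : ∀ X ⊆ U, (¬ ∃ k ∈ K, (#X : ZMod p) = k ∨ (#X : ZMod p) + 1 = k) → f X ≠ 0 := by
    intro X hX h
    rw [hfeval X hX]
    refine mul_ne_zero (Finset.prod_ne_zero_iff.2 fun k hk h0 => ?_)
      (Finset.prod_ne_zero_iff.2 fun k hk h0 => ?_)
    · exact h ⟨k, hk, Or.inl (by linear_combination h0)⟩
    · exact h ⟨k, hk, Or.inr (by linear_combination h0)⟩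
  set v : 𝒜 ⊕ D → Finset (Fin n) → ZMod p :=
    Sum.elim (fun A => g A) (fun I => f * setMonomial (ZMod p) (I : Finset (Fin n))) with hv
  have hmem : ∀ i, v i ∈ multilinearSpan (ZMod p) U #L := by
    have hone : (fun _ => 1) ∈ multilinearSpan (ZMod p) U 0 := by
      have : (fun _ => 1) = setMonomial (ZMod p) (∅ : Finset (Fin n)) := by
        funext X; simp [setMonomial]
      rw [this]
      exact setMonomial_mem_multilinearSpan (Finset.empty_subset _) (by simp)
    rintro (⟨A, hA⟩ | ⟨I, hI⟩)
    · have := prod_mul_mem_multilinearSpan (heU A) L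
        (fun l => (if e ∈ A then 1 else 0) - (l : ZMod p)) hone
      simpa [hv, hg] using this
    · have hK := hDL ⟨I, hI⟩
      have hI' := mem_smallSubsets.1 (hD hI)
      have h1 := setMonomial_mem_multilinearSpan (F := ZMod p) hI'.1 hI'.2
      have h2 := prod_mul_mem_multilinearSpan (Finset.Subset.refl U) K
        (fun k => 1 - (k : ZMod p)) h1
      have h3 := prod_mul_mem_multilinearSpan (Finset.Subset.refl U) K
        (fun k => -(k : ZMod p)) h2
      rw [show #L - 2 * #K + #K + #K = #L by omega] at h3
      convert h3 using 1
      funext X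
      simp only [hv, hf, Sum.elim_inr, Pi.mul_apply, mul_assoc]
  have hli : LinearIndependent (ZMod p) v := by
    rw [Fintype.linearIndependent_iff]
    intro c hc
    have hc' : ∀ X, ∑ A : 𝒜, c (Sum.inl A) * g A X +
        f X * ∑ I : D, c (Sum.inr I) * setMonomial (ZMod p) (I : Finset (Fin n)) X = 0 := by
      intro X
      have := congrFun hc X
      rw [Fintype.sum_sum_type] at this
      simp only [hv, Sum.elim_inl, Sum.elim_inr, Pi.add_apply, Finset.sum_apply, Pi.smul_apply,
        Pi.mul_apply, smul_eq_mul, Pi.zero_apply] at this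
      rw [Finset.mul_sum, ← this]
      congr 1
      exact Finset.sum_congr rfl fun _ _ => by ring
    have hB : ∀ B : 𝒜, (∀ A : 𝒜, A ≠ B → c (Sum.inl A) * g A ((B : Finset (Fin n)).erase e) = 0) →
        c (Sum.inl B) = 0 := by
      intro B hB
      have := hc' ((B : Finset (Fin n)).erase e)
      rw [hf0 B B.2, zero_mul, add_zero, Fintype.sum_eq_single B hB] at this
      exact (mul_eq_zero.1 this).resolve_right (hg1 B B.2)
    -- The system is triangular: `g A (B \ e)` can be nonzero for `A ≠ B` only if `e ∈ A` and `e ∉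
    -- B`, so sets containing `e` are treated before the others.
    have hB1 : ∀ B : 𝒜, e ∈ (B : Finset (Fin n)) → c (Sum.inl B) = 0 := fun B he =>
      hB B fun A hAB => by
        rw [hg0 A A.2 B B.2 (fun h => hAB (Subtype.ext h)) (Or.inl he), mul_zero]
    have hB2 : ∀ B : 𝒜, c (Sum.inl B) = 0 := fun B => hB B fun A hAB => by
      by_cases he : e ∈ (A : Finset (Fin n))
      · rw [hB1 A he, zero_mul]
      · rw [hg0 A A.2 B B.2 (fun h => hAB (Subtype.ext h)) (Or.inr he), mul_zero]
    set c' : Finset (Fin n) → ZMod p :=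
      fun I => if h : I ∈ D then c (Sum.inr ⟨I, h⟩) else 0 with hc'_def
    have hsum : ∀ X, ∑ I : D, c (Sum.inr I) * setMonomial (ZMod p) (I : Finset (Fin n)) X =
        ∑ I ∈ X.powerset, c' I := by
      intro X
      have h1 : ∑ I : D, c (Sum.inr I) * setMonomial (ZMod p) (I : Finset (Fin n)) X =
          ∑ I ∈ D, c' I * setMonomial (ZMod p) I X := by
        rw [← Finset.sum_coe_sort D]
        refine Finset.sum_congr rfl fun I _ => ?_
        simp [hc'_def]
      rw [h1]
      simp only [setMonomial, mul_ite, mul_one, mul_zero]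
      rw [← Finset.sum_filter]
      refine Finset.sum_subset_zero_on_sdiff (fun I hI => ?_) (fun I hI => ?_) fun _ _ => rfl
      · exact Finset.mem_powerset.2 (Finset.mem_filter.1 hI).2
      · rw [Finset.mem_sdiff, Finset.mem_powerset, Finset.mem_filter] at hI
        exact dif_neg fun h => hI.2 ⟨h, hI.1⟩
    have hzero : ∀ X ⊆ U, ∑ I ∈ X.powerset, c' I = 0 := by
      refine hvanish c' (fun I hI => dif_neg hI) fun X hX hXK => ?_
      have := hc' X
      rw [Finset.sum_eq_zero (fun A _ => by rw [hB2 A, zero_mul]), zero_add, hsum] at this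
      exact (mul_eq_zero.1 this).resolve_left (hf1 X hX hXK)
    rintro (B | ⟨I, hI⟩)
    · exact hB2 B
    · have := eq_zero_of_sum_powerset_eq_zero hzero I (mem_smallSubsets.1 (hD hI)).1
      exact (dif_pos hI).symm.trans this
  have := card_le_card_smallSubsets hli hmem
  rwa [Fintype.card_sum, Fintype.card_coe, Fintype.card_coe, card_smallSubsets, hUcard] at this

open Finset in
theorem card_le_chooseSum {p n : ℕ} [Fact p.Prime] {K L : Finset ℕ} (hK : K.Nonempty)
    (hKp : ∀ k ∈ K, k < p) (hLp : ∀ l ∈ L, l < p) (hKL : Disjoint K L)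
    (𝒜 : Finset (Finset (Fin n))) (hcard : ∀ A ∈ 𝒜, #A % p ∈ K)
    (hinter : ∀ A ∈ 𝒜, ∀ B ∈ 𝒜, A ≠ B → #(A ∩ B) % p ∈ L)
    (hn : #L + K.max' hK ≤ n) (hn0 : 0 < n) :
    #𝒜 ≤ chooseSum (n - 1) #L (2 * #K) := by
  have hK0 : 1 ≤ #K := Finset.card_pos.2 hK
  have hp : #L + #K ≤ p := by
    rw [add_comm, ← Finset.card_union_of_disjoint hKL]
    have : K ∪ L ⊆ range p := by
      intro x hx
      rcases Finset.mem_union.1 hx with h | h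
      · exact Finset.mem_range.2 (hKp x h)
      · exact Finset.mem_range.2 (hLp x h)
    simpa using Finset.card_le_card this
  set e : Fin n := ⟨0, hn0⟩
  have hUcard : #(univ.erase e) = n - 1 := by
    rw [Finset.card_erase_of_mem (Finset.mem_univ e), Finset.card_univ, Fintype.card_fin]
  have hs := chooseSum_add_sum_range_le (n - 1) #L (2 * #K)
  by_cases h : 2 * #K ≤ #L
  · have := card_add_sum_choose_le hLp hKL 𝒜 hcard hinter e
      (smallSubsets (univ.erase e) (#L - 2 * #K)) (Finset.Subset.refl _) (fun _ => h) ?_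
    · rw [card_smallSubsets, hUcard] at this
      rw [if_pos h] at hs
      omega
    · intro c hc hX
      refine sum_powerset_eq_zero_of_vanishing (#L - 2 * #K) (by omega) _ c ?_
        (fun t => ∃ k ∈ K, (t : ZMod p) = k ∨ (t : ZMod p) + 1 = k) ?_ hX
      · exact fun I hI => hc I fun h => by have := (mem_smallSubsets.1 h).2; omega
      · intro j hj hjU
        rw [hUcard] at hjU ⊢
        exact exists_injOn_sizes (M := K.max' hK) rfl hK0 hKp (fun k hk => K.le_max' k hk) hp (by omega) h hj hjU
  · have := card_add_sum_choose_le hLp hKL 𝒜 hcard hinter e ∅ (Finset.empty_subset _)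
      (fun h => absurd h (by simp)) ?_
    · rw [Finset.card_empty] at this
      rw [if_neg h] at hs
      omega
    · intro c hc _ X _
      exact Finset.sum_eq_zero fun I _ => hc I (by simp)

theorem mainTheorem1 (p : ℕ) (hp : p.Prime) (n : ℕ) (K L : Finset ℕ) (hK : K.Nonempty)
    (hKp : ∀ k ∈ K, k < p) (hLp : ∀ l ∈ L, l < p) (hKL : Disjoint K L)
    (𝒜 : Finset (Finset (Fin n)))
    (hcard : ∀ A ∈ 𝒜, A.card % p ∈ K)
    (hinter : ∀ A ∈ 𝒜, ∀ B ∈ 𝒜, A ≠ B → (A ∩ B).card % p ∈ L)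
    (hn : L.card + K.max' hK ≤ n) :
    𝒜.card ≤ chooseSum (n - 1) L.card (2 * K.card) ∧
      (2 * L.card ≤ n + 2 →
        chooseSum (n - 1) L.card (2 * K.card) ≤ chooseSum n L.card K.card ∧
        (2 ≤ K.card → 1 ≤ L.card →
          chooseSum (n - 1) L.card (2 * K.card) < chooseSum n L.card K.card)) := by
  have := Fact.mk hp
  -- For `n = 0` there is no point to remove; truncation makes `n - 1 = 0`, matching the convention
  -- for `C(-1, 0)`.
  rcases Nat.eq_zero_or_pos n with rfl | hn0
  · have hL0 : L.card = 0 := by omega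
    have hK0 : 1 ≤ K.card := Finset.card_pos.2 hK
    have h1 : ∀ l, 1 ≤ l → chooseSum 0 0 l = 1 := by
      intro l hl
      simp [chooseSum, Nat.sub_eq_zero_of_le hl]
    rw [hL0, h1 _ (by omega), h1 _ hK0]
    refine ⟨?_, fun _ => ⟨le_rfl, fun _ h => absurd h (by omega)⟩⟩
    exact Finset.card_le_one.2 fun A _ B _ => Subsingleton.elim A B
  · refine ⟨card_le_chooseSum hK hKp hLp hKL 𝒜 hcard hinter hn hn0, fun h => ?_⟩
    obtain ⟨N, rfl⟩ : ∃ N, n = N + 1 := ⟨n - 1, by omega⟩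
    exact chooseSum_two_mul_le (by omega)
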